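/- **Twisted Jacobi identity of order 3.** Let $q\in\mathbb C$ with $0<|q|<1$, and let $q^{1/2}$ be either square root of $q$ (half-integral powers of $q$ are powers of this root). Then all the infinite products below converge and $$\frac{1}{2q^{1/2}}\left\{\prod_{n\ge 1}(1+q^{3n-3/2})^2(1+q^{n-1/2})^2-\prod_{n\ge 1}(1-q^{3n-3/2})^2(1-q^{n-1/2})^2\right\}=2\prod_{n\ge 1}(1+q^{3n})^2(1+q^n)^2 .$$ For $q=0$ the identity holds as well, with the left-hand side read as its limit as $q^{1/2}\to 0$. Consequently the following even and odd trace generating functions agree (supersymmetry). Let $\rho$ be a permutation of the coordinates of an $8$-dimensional space with cycle shape $1^2 3^2$ (two fixed points and two $3$-cycles), and let $\varepsilon_1,\dots,\varepsilon_8\in\mathbb C$ be its eigenvalues, listed with multiplicity. Then for all $q\in\mathbb C$ with $|q|<1$, and either choice of $q^{1/2}$, the products converge and $$\frac12\left(\prod_{n\ge 1}\prod_{i=1}^{8}\frac{1+\varepsilon_i q^{n-1/2}}{1-\varepsilon_i q^n}-\prod_{n\ge 1}\prod_{i=1}^{8}\frac{1-\varepsilon_i q^{n-1/2}}{1-\varepsilon_i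 q^n}\right)=\operatorname{tr}(\rho)\,q^{1/2}\prod_{n\ge 1}\prod_{i=1}^{8}\frac{1+\varepsilon_i q^n}{1-\varepsilon_i q^n}.$$ -/

import Mathlib

open Filter Topology

noncomputable section

/-- Eigenvalues, with multiplicity, of the permutation `σ` of the coordinates of an 8-dimensional
space: the roots of the characteristic polynomial of its permutation matrix. -/
def coordEigenvalues (σ : Equiv.Perm (Fin 8)) : Multiset ℂ :=
  (Equiv.Perm.permMatrix ℂ σ).charpoly.roots

/-- The factor `∏ (1 + s ε q^(n-1/2)) / (1 - ε q^n)`, the product over the eigenvalues `ε`,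
where `x = q^(1/2)` and `n ≥ 1`. -/
def evenTraceFactor (σ : Equiv.Perm (Fin 8)) (s x : ℂ) (n : ℕ+) : ℂ :=
  ((coordEigenvalues σ).map fun ε =>
    (1 + s * ε * x ^ (2 * (n : ℕ) - 1)) / (1 - ε * x ^ (2 * (n : ℕ)))).prod

/-- The factor `∏ (1 + ε q^n) / (1 - ε q^n)`, the product over the eigenvalues `ε`,
where `x = q^(1/2)`. -/
def oddTraceFactor (σ : Equiv.Perm (Fin 8)) (x : ℂ) (n : ℕ+) : ℂ :=
  ((coordEigenvalues σ).map fun ε =>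
    (1 + ε * x ^ (2 * (n : ℕ))) / (1 - ε * x ^ (2 * (n : ℕ)))).prod

/-- Generating function of the traces on the even spaces, as a function of `x = q^(1/2)`. -/
def evenTraceGenFun (σ : Equiv.Perm (Fin 8)) (x : ℂ) : ℂ :=
  1 / 2 * ((∏' n : ℕ+, evenTraceFactor σ 1 x n) - ∏' n : ℕ+, evenTraceFactor σ (-1) x n)

/-- Generating function of the traces on the odd spaces, as a function of `x = q^(1/2)`. -/
def oddTraceGenFun (σ : Equiv.Perm (Fin 8)) (x : ℂ) : ℂ :=
  (Equiv.Perm.permMatrix ℂ σ).trace * x * ∏' n : ℕ+, oddTraceFactor σ x n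

/-- The `n`-th factor `(1 + s q^(3n-3/2))^2 (1 + s q^(n-1/2))^2`, where `x = q^(1/2)`. -/
def halfIntegralFactor (s x : ℂ) (n : ℕ+) : ℂ :=
  (1 + s * x ^ (6 * (n : ℕ) - 3)) ^ 2 * (1 + s * x ^ (2 * (n : ℕ) - 1)) ^ 2

/-- The `n`-th factor `(1 + q^(3n))^2 (1 + q^n)^2`. -/
def integralFactor (q : ℂ) (n : ℕ+) : ℂ :=
  (1 + q ^ (3 * (n : ℕ))) ^ 2 * (1 + q ^ (n : ℕ)) ^ 2

/-- Left-hand side of the twisted Jacobi identity, as a function of `x = q^(1/2)`. -/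
def twistedJacobiLHS (x : ℂ) : ℂ :=
  1 / (2 * x) *
    ((∏' n : ℕ+, halfIntegralFactor 1 x n) - ∏' n : ℕ+, halfIntegralFactor (-1) x n)

/-- Right-hand side of the twisted Jacobi identity. -/
def twistedJacobiRHS (q : ℂ) : ℂ :=
  2 * ∏' n : ℕ+, integralFactor q n

end

/-! Put `x = q^(1/2)`. The Jacobi triple product (`jacobi_triple_product`) turns each infinite
product, times the Euler products in `x^2` and `x^6`, into a product of theta series at `x` and
`x^3`. The identity becomes `θ₃(x)θ₃(x³) - θ₄(x)θ₄(x³) = θ₂(x)θ₂(x³)` (`theta_cubic_identity`). Both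
sides sum powers of `x` over norms of Eisenstein integers of odd norm. The left side is twice the
sum over `a + b√-3` with `a + b` odd, the right side the sum over half-integral points. The latter
form two residue classes mod 2, each obtained from the former by multiplication by a cube root of
unity (`tsum_odd_form_eq_tsum`). For supersymmetry, the eigenvalues are four 1s and each primitive
cube root of unity twice. So the trace factors are those of the identity over a common denominator,
and the trace is 2. -/

/-! ### Finite form of the triple product -/

/-- The finite `q`-Pochhammer symbol `(q; q)_n`. -/
def qFac (q : ℂ) (n : ℕ) : ℂ := ∏ i ∈ Finset.range n, (1 - q ^ (i + 1))

/-- The reciprocal of `(q; q)_m`, with value `0` at negative `m`. -/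
noncomputable def invQFac (q : ℂ) (m : ℤ) : ℂ := if 0 ≤ m then (qFac q m.toNat)⁻¹ else 0

lemma one_sub_pow_succ_ne_zero {q : ℂ} (hq : ‖q‖ < 1) (n : ℕ) : 1 - q ^ (n + 1) ≠ 0 := by
  intro h
  have h1 : ‖q‖ ^ (n + 1) = 1 := by rw [← norm_pow, ← sub_eq_zero.mp h, norm_one]
  exact (pow_lt_one₀ (norm_nonneg q) hq n.succ_ne_zero).ne h1

lemma qFac_ne_zero {q : ℂ} (hq : ‖q‖ < 1) (n : ℕ) : qFac q n ≠ 0 :=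
  Finset.prod_ne_zero_iff.mpr fun i _ => one_sub_pow_succ_ne_zero hq i

lemma qFac_succ (q : ℂ) (n : ℕ) : qFac q (n + 1) = qFac q n * (1 - q ^ (n + 1)) :=
  Finset.prod_range_succ _ _

/-- At `m = 0` the factor `1 - q^m` vanishes, so the zero convention makes one recurrence cover all
integers. -/
lemma invQFac_sub_one {q : ℂ} (hq : ‖q‖ < 1) (m : ℤ) :
    invQFac q (m - 1) = (1 - q ^ m) * invQFac q m := by
  rcases lt_trichotomy m 0 with h | rfl | h
  · simp [invQFac, not_le.mpr h, show ¬ (1 ≤ m) by omega]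
  · simp [invQFac]
  · obtain ⟨n, rfl⟩ : ∃ n : ℕ, m = n + 1 := ⟨(m - 1).toNat, by omega⟩
    have h1 := one_sub_pow_succ_ne_zero hq n
    have h2 := qFac_ne_zero hq n
    have e : ((n : ℤ) + 1).toNat = n + 1 := by omega
    have e' : q ^ ((n : ℤ) + 1) = q ^ (n + 1) := by exact_mod_cast zpow_natCast q (n + 1)
    simp only [invQFac, add_sub_cancel_right, Int.natCast_nonneg, if_true, Int.toNat_natCast,
      if_pos h.le, e, qFac_succ, e']
    field_simp

/-- The coefficient of `z ^ j` in `∏ k < N, (1 + x ^ (2k+1) z) (1 + x ^ (2k+1) z⁻¹)`. -/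
noncomputable def tripleCoeff (x : ℂ) (N : ℕ) (j : ℤ) : ℂ :=
  x ^ (j ^ 2) * (qFac (x ^ 2) (2 * N) * invQFac (x ^ 2) (N + j) * invQFac (x ^ 2) (N - j))

/-- This compares coefficients after multiplying by the next factor, `1 + x^(4N+2) + x^(2N+1) (z +
z⁻¹)`. -/
lemma tripleCoeff_succ {x : ℂ} (hx0 : x ≠ 0) (hx : ‖x‖ < 1) (N : ℕ) (j : ℤ) :
    tripleCoeff x (N + 1) j = (1 + x ^ (4 * N + 2)) * tripleCoeff x N j +
      x ^ (2 * N + 1) * (tripleCoeff x N (j - 1) + tripleCoeff x N (j + 1)) := by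
  have hq : ‖x ^ 2‖ < 1 := by
    rw [norm_pow]; exact pow_lt_one₀ (norm_nonneg x) hx two_ne_zero
  have step := invQFac_sub_one hq
  -- All reciprocals are expressed through those at `N + j + 1` and `N - j + 1`, leaving a rational
  -- identity in `x`, `x^(2N)` and `x^(2j)`.
  have a1 := step (N + j + 1)
  have a2 := step (N + j)
  have b1 := step (N - j + 1)
  have b2 := step (N - j)
  have z (k : ℤ) : (x ^ 2) ^ k = x ^ (2 * k) := by rw [zpow_mul]; norm_cast
  rw [z] at a1 a2 b1 b2
  rw [add_sub_cancel_right] at a1 b1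
  rw [a1] at a2
  rw [b1] at b2
  simp only [tripleCoeff]
  push_cast
  rw [show (N : ℤ) + 1 + j = N + j + 1 by ring, show (N : ℤ) + 1 - j = N - j + 1 by ring,
    show (N : ℤ) + (j - 1) = N + j - 1 by ring, show (N : ℤ) - (j - 1) = N - j + 1 by ring,
    show (N : ℤ) + (j + 1) = N + j + 1 by ring, show (N : ℤ) - (j + 1) = N - j - 1 by ring,
    a2, b2, a1, b1, show 2 * (N + 1) = 2 * N + 1 + 1 by ring, qFac_succ, qFac_succ]
  generalize invQFac (x ^ 2) (N + j + 1) = U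
  generalize invQFac (x ^ 2) (N - j + 1) = V
  generalize qFac (x ^ 2) (2 * N) = Q
  rw [show (j - 1) ^ 2 = j ^ 2 + (-(2 * j) + 1) by ring,
    show (j + 1) ^ 2 = j ^ 2 + (2 * j + 1) by ring,
    show 2 * ((N : ℤ) + j + 1) = 2 * N + 2 * j + 2 by ring,
    show 2 * ((N : ℤ) - j + 1) = 2 * N + -(2 * j) + 2 by ring,
    show 2 * ((N : ℤ) + j) = 2 * N + 2 * j by ring,
    show 2 * ((N : ℤ) - j) = 2 * N + -(2 * j) by ring]
  simp only [zpow_add₀ hx0, zpow_neg]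
  have hN : x ^ (2 * (N : ℤ)) = x ^ (2 * N) := by exact_mod_cast zpow_natCast x (2 * N)
  rw [hN]
  have hy : x ^ (2 * j) ≠ 0 := zpow_ne_zero _ hx0
  have e1 : (x ^ 2) ^ (2 * N + 1) = (x ^ (2 * N)) ^ 2 * x ^ 2 := by ring
  have e2 : (x ^ 2) ^ (2 * N + 1 + 1) = (x ^ (2 * N)) ^ 2 * x ^ 4 := by ring
  have e3 : x ^ (4 * N + 2) = (x ^ (2 * N)) ^ 2 * x ^ 2 := by ring
  have e4 : x ^ (2 * N + 1) = x ^ (2 * N) * x := by ring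
  rw [e1, e2, e3, e4]
  generalize x ^ (2 * j) = y at *
  generalize x ^ (2 * N) = w
  generalize x ^ (j ^ 2) = t
  rw [show x ^ (2 : ℤ) = x ^ 2 from by norm_cast, zpow_one]
  field_simp
  ring

lemma hasSum_finite_tripleProduct {x z : ℂ} (hx0 : x ≠ 0) (hx : ‖x‖ < 1) (hz : z ≠ 0) (N : ℕ) :
    HasSum (fun j : ℤ => tripleCoeff x N j * z ^ j)
      (∏ k ∈ Finset.range N, ((1 + x ^ (2 * k + 1) * z) * (1 + x ^ (2 * k + 1) * z⁻¹))) := by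
  induction N with
  | zero =>
    convert hasSum_single (f := fun j : ℤ => tripleCoeff x 0 j * z ^ j) 0 ?_
    · simp [tripleCoeff, invQFac, qFac]
    · intro j hj
      -- For `N = 0` and `j ≠ 0`, one of the indices `j`, `-j` is negative.
      rcases lt_or_gt_of_ne hj with h | h
      · simp [tripleCoeff, invQFac, not_le.mpr h]
      · simp [tripleCoeff, invQFac, not_le.mpr h]
  | succ N ih =>
    set P := ∏ k ∈ Finset.range N, ((1 + x ^ (2 * k + 1) * z) * (1 + x ^ (2 * k + 1) * z⁻¹))
      with hP
    have h1 : HasSum (fun j : ℤ => tripleCoeff x N (j - 1) * z ^ (j - 1)) P :=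
      ((Equiv.subRight (1 : ℤ)).hasSum_iff (f := fun j : ℤ => tripleCoeff x N j * z ^ j)).mpr ih
    have h2 : HasSum (fun j : ℤ => tripleCoeff x N (j + 1) * z ^ (j + 1)) P :=
      ((Equiv.addRight (1 : ℤ)).hasSum_iff (f := fun j : ℤ => tripleCoeff x N j * z ^ j)).mpr ih
    have key := (ih.mul_left (1 + x ^ (4 * N + 2))).add
      ((h1.mul_left (x ^ (2 * N + 1) * z)).add (h2.mul_left (x ^ (2 * N + 1) * z⁻¹)))
    have hprod : P * ((1 + x ^ (2 * N + 1) * z) * (1 + x ^ (2 * N + 1) * z⁻¹)) =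
        (1 + x ^ (4 * N + 2)) * P + (x ^ (2 * N + 1) * z * P + x ^ (2 * N + 1) * z⁻¹ * P) := by
      have hzz : z * z⁻¹ = 1 := mul_inv_cancel₀ hz
      linear_combination (x ^ (2 * N + 1)) ^ 2 * P * hzz
    rw [Finset.prod_range_succ, ← hP, hprod]
    refine key.congr_fun fun j => ?_
    rw [tripleCoeff_succ hx0 hx, zpow_add₀ hz, zpow_sub₀ hz, zpow_one]
    field_simp

/-! ### Convergence and the infinite triple product -/

/-- With `x = exp(πiτ)` and `z = exp(2πiw)` these are the terms of `jacobiTheta₂`, and `‖x‖ < 1`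
means `0 < τ.im`. -/
lemma summable_norm_theta {x z : ℂ} (hx0 : x ≠ 0) (hx : ‖x‖ < 1) (hz : z ≠ 0) :
    Summable (fun j : ℤ => ‖x ^ (j ^ 2) * z ^ j‖) := by
  have hpi : (Real.pi : ℂ) ≠ 0 := by exact_mod_cast Real.pi_ne_zero
  set τ : ℂ := Complex.log x / (Real.pi * Complex.I) with hτ
  set w : ℂ := Complex.log z / (2 * Real.pi * Complex.I) with hw
  have h1 : Real.pi * Complex.I * τ = Complex.log x := by
    rw [hτ]; field_simp
  have h2 : 2 * Real.pi * Complex.I * w = Complex.log z := by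
    rw [hw]; field_simp
  have him : 0 < τ.im := by
    have h3 : (Complex.log x).re < 0 := by
      rw [Complex.log_re]; exact Real.log_neg (norm_pos_iff.mpr hx0) hx
    rw [← h1] at h3
    simp at h3
    exact pos_of_mul_pos_right h3 Real.pi_pos.le
  refine ((summable_jacobiTheta₂_term_iff w τ).mpr him).norm.congr fun j => ?_
  rw [jacobiTheta₂_term, show 2 * Real.pi * Complex.I * j * w + Real.pi * Complex.I * j ^ 2 * τ =
    ((j ^ 2 : ℤ) : ℂ) * Complex.log x + (j : ℂ) * Complex.log z by
      rw [← h1, ← h2]; push_cast; ring, Complex.exp_add, Complex.exp_int_mul,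
    Complex.exp_int_mul, Complex.exp_log hx0, Complex.exp_log hz]

lemma summable_norm_pow_comp {x : ℂ} (hx : ‖x‖ < 1) {f : ℕ → ℕ} (hf : ∀ n, n ≤ f n) :
    Summable (fun n : ℕ => ‖x ^ f n‖) := by
  refine (summable_geometric_of_lt_one (norm_nonneg x) hx).of_nonneg_of_le
    (fun _ => norm_nonneg _) fun n => ?_
  rw [norm_pow]
  exact pow_le_pow_of_le_one (norm_nonneg x) hx.le (hf n)

lemma multipliable_one_add_mul_pow {x : ℂ} (hx : ‖x‖ < 1) (c : ℂ) {f : ℕ → ℕ}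
    (hf : ∀ n, n ≤ f n) : Multipliable (fun n : ℕ => 1 + c * x ^ f n) :=
  multipliable_one_add_of_summable
    (((summable_norm_pow_comp hx hf).mul_left ‖c‖).congr fun _ => (norm_mul _ _).symm)

lemma multipliable_one_sub_pow_succ {q : ℂ} (hq : ‖q‖ < 1) :
    Multipliable (fun n : ℕ => 1 - q ^ (n + 1)) := by
  simpa [sub_eq_add_neg] using
    multipliable_one_add_mul_pow hq (-1) (f := fun n => n + 1) (fun n => n.le_succ)

lemma tprod_one_sub_pow_succ_ne_zero {q : ℂ} (hq : ‖q‖ < 1) :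
    ∏' n : ℕ, (1 - q ^ (n + 1)) ≠ 0 := by
  simp only [sub_eq_add_neg]
  refine tprod_one_add_ne_zero_of_summable (f := fun n : ℕ => -q ^ (n + 1)) (fun n => ?_) ?_
  · simpa [sub_eq_add_neg] using one_sub_pow_succ_ne_zero hq n
  · simpa using summable_norm_pow_comp hq (f := fun n => n + 1) (fun n => n.le_succ)

lemma tendsto_qFac {q : ℂ} (hq : ‖q‖ < 1) :
    Tendsto (qFac q) atTop (𝓝 (∏' n : ℕ, (1 - q ^ (n + 1)))) :=
  (multipliable_one_sub_pow_succ hq).hasProd.tendsto_prod_nat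

lemma tendsto_invQFac {q : ℂ} (hq : ‖q‖ < 1) :
    Tendsto (invQFac q) atTop (𝓝 (∏' n : ℕ, (1 - q ^ (n + 1)))⁻¹) := by
  have h : Tendsto Int.toNat atTop atTop :=
    tendsto_atTop_atTop.mpr fun b => ⟨b, fun a h => by omega⟩
  refine (((tendsto_qFac hq).inv₀ (tprod_one_sub_pow_succ_ne_zero hq)).comp h).congr' ?_
  filter_upwards [eventually_ge_atTop 0] with m hm
  simp [invQFac, hm]

lemma exists_norm_qFac_le {q : ℂ} (hq : ‖q‖ < 1) : ∃ C, ∀ n, ‖qFac q n‖ ≤ C := by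
  obtain ⟨C, hC⟩ := (tendsto_qFac hq).norm.bddAbove_range
  exact ⟨C, fun n => hC ⟨n, rfl⟩⟩

lemma exists_norm_invQFac_le {q : ℂ} (hq : ‖q‖ < 1) : ∃ C, 0 ≤ C ∧ ∀ m, ‖invQFac q m‖ ≤ C := by
  obtain ⟨C, hC⟩ :=
    ((tendsto_qFac hq).inv₀ (tprod_one_sub_pow_succ_ne_zero hq)).norm.bddAbove_range
  have hC' (n : ℕ) : ‖(qFac q n)⁻¹‖ ≤ C := hC ⟨n, rfl⟩
  have h0 : 0 ≤ C := (norm_nonneg _).trans (hC' 0)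
  refine ⟨C, h0, fun m => ?_⟩
  unfold invQFac
  split_ifs
  · exact hC' _
  · simpa using h0

/-- **Jacobi triple product identity**. -/
theorem jacobi_triple_product {x z : ℂ} (hx0 : x ≠ 0) (hx : ‖x‖ < 1) (hz : z ≠ 0) :
    (∏' n : ℕ, (1 - (x ^ 2) ^ (n + 1))) *
      ((∏' n : ℕ, (1 + x ^ (2 * n + 1) * z)) * ∏' n : ℕ, (1 + x ^ (2 * n + 1) * z⁻¹)) =
    ∑' j : ℤ, x ^ (j ^ 2) * z ^ j := by
  have hq : ‖x ^ 2‖ < 1 := by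
    rw [norm_pow]; exact pow_lt_one₀ (norm_nonneg x) hx two_ne_zero
  set E := ∏' n : ℕ, (1 - (x ^ 2) ^ (n + 1)) with hE
  have hE0 : E ≠ 0 := tprod_one_sub_pow_succ_ne_zero hq
  have mul (w : ℂ) : Tendsto (fun N => ∏ k ∈ Finset.range N, (1 + x ^ (2 * k + 1) * w)) atTop
      (𝓝 (∏' n : ℕ, (1 + x ^ (2 * n + 1) * w))) := by
    simp only [mul_comm _ w]
    exact (multipliable_one_add_mul_pow hx w (f := fun n => 2 * n + 1)
      fun n => by omega).hasProd.tendsto_prod_nat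
  have hL := (mul z).mul (mul z⁻¹)
  simp only [← Finset.prod_mul_distrib] at hL
  obtain ⟨C, hC⟩ := exists_norm_qFac_le hq
  obtain ⟨D, hD0, hD⟩ := exists_norm_invQFac_le hq
  have hR : Tendsto (fun N : ℕ => ∑' j : ℤ, tripleCoeff x N j * z ^ j) atTop
      (𝓝 (∑' j : ℤ, E⁻¹ * (x ^ (j ^ 2) * z ^ j))) := by
    -- The Pochhammer symbols and their reciprocals are bounded uniformly in the index, so a
    -- multiple of the theta series dominates.
    refine tendsto_tsum_of_dominated_convergence
      ((summable_norm_theta hx0 hx hz).mul_left (C * D * D)) (fun j => ?_)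
      (Eventually.of_forall fun N j => ?_)
    · have t1 : Tendsto (fun N : ℕ => qFac (x ^ 2) (2 * N)) atTop (𝓝 E) :=
        (tendsto_qFac hq).comp (tendsto_atTop_atTop.mpr fun b => ⟨b, fun a h => by omega⟩)
      have t2 : Tendsto (fun N : ℕ => invQFac (x ^ 2) (N + j)) atTop (𝓝 E⁻¹) :=
        (tendsto_invQFac hq).comp
          (tendsto_atTop_atTop.mpr fun b => ⟨(b - j).toNat, fun a h => by omega⟩)
      have t3 : Tendsto (fun N : ℕ => invQFac (x ^ 2) (N - j)) atTop (𝓝 E⁻¹) :=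
        (tendsto_invQFac hq).comp
          (tendsto_atTop_atTop.mpr fun b => ⟨(b + j).toNat, fun a h => by omega⟩)
      have t := (((t1.mul t2).mul t3).const_mul (x ^ (j ^ 2))).mul_const (z ^ j)
      rwa [show x ^ (j ^ 2) * (E * E⁻¹ * E⁻¹) * z ^ j = E⁻¹ * (x ^ (j ^ 2) * z ^ j) by
        rw [mul_inv_cancel₀ hE0]; ring] at t
    · rw [tripleCoeff, show ∀ a b c d e : ℂ, a * (b * c * d) * e = b * c * d * (a * e) by
        intros; ring, norm_mul]
      refine mul_le_mul_of_nonneg_right ?_ (norm_nonneg _)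
      rw [norm_mul, norm_mul]
      have hC0 := (norm_nonneg _).trans (hC (2 * N))
      gcongr
      exacts [hC _, hD _, hD _]
  have := tendsto_nhds_unique (hL.congr fun N =>
    (hasSum_finite_tripleProduct hx0 hx hz N).tsum_eq.symm) hR
  rw [this, tsum_mul_left, mul_inv_cancel_left₀ hE0]

/-! ### Cubic theta identity -/

/-- The quadratic form identity behind the cubic theta function identity: multiplication by a
cube root of unity on the Eisenstein integers. -/
lemma tsum_odd_form_eq_tsum {x : ℂ}
    (hH : Summable fun p : ℤ × ℤ => x ^ (p.1 ^ 2 + p.1 + 3 * (p.2 ^ 2 + p.2) + 1)) :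
    ∑' p : ℤ × ℤ, (1 - (-1) ^ (p.1 + p.2)) * x ^ (p.1 ^ 2 + 3 * p.2 ^ 2) =
      ∑' p : ℤ × ℤ, x ^ (p.1 ^ 2 + p.1 + 3 * (p.2 ^ 2 + p.2) + 1) := by
  set H : ℤ × ℤ → ℂ := fun p => x ^ (p.1 ^ 2 + p.1 + 3 * (p.2 ^ 2 + p.2) + 1) with hHdef
  have hsign : Summable fun p : ℤ × ℤ => (-1 : ℂ) ^ (p.1 + p.2) * H p :=
    .of_norm (hH.norm.congr fun p => by simp)
  -- Complex conjugation, `b ↦ -1 - b` in these coordinates, preserves the norm and flips the parity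
  -- of `a + b`. Hence the two parity classes contribute equally.
  have hzero : ∑' p : ℤ × ℤ, (-1 : ℂ) ^ (p.1 + p.2) * H p = 0 := by
    have e := ((Equiv.refl ℤ).prodCongr (Equiv.subLeft (-1 : ℤ))).tsum_eq
      (fun p : ℤ × ℤ => (-1 : ℂ) ^ (p.1 + p.2) * H p)
    have e2 : ∑' p : ℤ × ℤ, (-1 : ℂ) ^ (p.1 + p.2) * H p =
        ∑' p : ℤ × ℤ, -((-1 : ℂ) ^ (p.1 + p.2) * H p) := by
      rw [← e]
      refine tsum_congr fun p => ?_
      have h1 : (-1 : ℂ) ^ (p.1 + (-1 - p.2)) = -(-1) ^ (p.1 + p.2) := by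
        rw [show p.1 + (-1 - p.2) = p.1 + p.2 + (-1 + 2 * (-p.2)) by ring,
          zpow_add₀ (by norm_num),
          Odd.neg_one_zpow (n := -1 + 2 * (-p.2)) ⟨-1 - p.2, by ring⟩]
        ring
      have h2 : H (p.1, -1 - p.2) = H p := by
        simp only [hHdef]; congr 1; ring
      change (-1 : ℂ) ^ (p.1 + (-1 - p.2)) * H (p.1, -1 - p.2) = _
      rw [h1, h2, neg_mul]
    rw [tsum_neg] at e2
    exact self_eq_neg.mp e2
  have hR : ∑' p, H p = ∑' p : ℤ × ℤ, (1 + (-1) ^ (p.1 + p.2)) * H p := by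
    simp only [add_mul, one_mul]
    rw [hH.tsum_add hsign, hzero, add_zero]
  have hodd : ∑' p : ℤ × ℤ, 2 * x ^ ((-(2 * p.1 + p.2 + 1)) ^ 2 + 3 * p.2 ^ 2) =
      ∑' p : ℤ × ℤ, (1 - (-1) ^ (p.1 + p.2)) * x ^ (p.1 ^ 2 + 3 * p.2 ^ 2) := by
    rw [← Function.Injective.tsum_eq (g := fun p : ℤ × ℤ => (-(2 * p.1 + p.2 + 1), p.2))
      (f := fun p : ℤ × ℤ => (1 - (-1) ^ (p.1 + p.2)) * x ^ (p.1 ^ 2 + 3 * p.2 ^ 2))]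
    · refine tsum_congr fun p => ?_
      rw [Odd.neg_one_zpow (n := -(2 * p.1 + p.2 + 1) + p.2) ⟨-p.1 - 1, by ring⟩]
      norm_num
    · intro p p' h
      simp only [Prod.mk.injEq] at h
      ext <;> omega
    · intro p hp
      rcases Int.even_or_odd (p.1 + p.2) with h | ⟨k, hk⟩
      · simp [h.neg_one_zpow] at hp
      · exact ⟨(-k - 1, p.2), by ext <;> simp; omega⟩
  have heven : ∑' p : ℤ × ℤ, 2 * H (p.1 + 2 * p.2, p.1) =
      ∑' p : ℤ × ℤ, (1 + (-1) ^ (p.1 + p.2)) * H p := by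
    rw [← Function.Injective.tsum_eq (g := fun p : ℤ × ℤ => (p.1 + 2 * p.2, p.1))
      (f := fun p : ℤ × ℤ => (1 + (-1) ^ (p.1 + p.2)) * H p)]
    · refine tsum_congr fun p => ?_
      rw [Even.neg_one_zpow (n := p.1 + 2 * p.2 + p.1) ⟨p.1 + p.2, by ring⟩]
      norm_num
    · intro p p' h
      simp only [Prod.mk.injEq] at h
      ext <;> omega
    · intro p hp
      rcases Int.even_or_odd (p.1 + p.2) with ⟨k, hk⟩ | h
      · exact ⟨(p.2, k - p.2), by ext <;> simp; omega⟩
      · simp [h.neg_one_zpow] at hp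
  -- The two parametrizations are matched so that `(-1 - √-3)/2` times the odd point is the
  -- half-integral point `(a + 1/2) + (b + 1/2)√-3`. The exponents therefore agree term by term.
  rw [hR, ← hodd, ← heven]
  refine tsum_congr fun p => ?_
  simp only [hHdef]
  ring_nf

/-- The cubic theta function identity `θ₃(x) θ₃(x³) - θ₄(x) θ₄(x³) = θ₂(x) θ₂(x³)`. -/
theorem theta_cubic_identity {x : ℂ} (hx0 : x ≠ 0) (hx : ‖x‖ < 1) :
    (∑' j : ℤ, x ^ (j ^ 2) * 1 ^ j) * (∑' j : ℤ, (x ^ 3) ^ (j ^ 2) * 1 ^ j) -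
      (∑' j : ℤ, x ^ (j ^ 2) * (-1) ^ j) * (∑' j : ℤ, (x ^ 3) ^ (j ^ 2) * (-1) ^ j) =
    x * ((∑' j : ℤ, x ^ (j ^ 2) * x ^ j) * ∑' j : ℤ, (x ^ 3) ^ (j ^ 2) * (x ^ 3) ^ j) := by
  have hy0 : x ^ 3 ≠ 0 := pow_ne_zero 3 hx0
  have hy : ‖x ^ 3‖ < 1 := by
    rw [norm_pow]; exact pow_lt_one₀ (norm_nonneg x) hx three_ne_zero
  have hz (k : ℤ) : (x ^ 3) ^ k = x ^ (3 * k) := by rw [zpow_mul]; norm_cast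
  have s1 := summable_norm_theta hx0 hx one_ne_zero
  have s2 := summable_norm_theta hy0 hy one_ne_zero
  have s3 := summable_norm_theta hx0 hx (neg_ne_zero.mpr one_ne_zero)
  have s4 := summable_norm_theta hy0 hy (neg_ne_zero.mpr one_ne_zero)
  have s5 := summable_norm_theta hx0 hx hx0
  have s6 := summable_norm_theta hy0 hy hy0
  rw [tsum_mul_tsum_of_summable_norm s1 s2, tsum_mul_tsum_of_summable_norm s3 s4,
    tsum_mul_tsum_of_summable_norm s5 s6, ← tsum_mul_left,
    ← (summable_mul_of_summable_norm s1 s2).tsum_sub (summable_mul_of_summable_norm s3 s4)]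
  have hRterm (p : ℤ × ℤ) : x * (x ^ (p.1 ^ 2) * x ^ p.1 *
      ((x ^ 3) ^ (p.2 ^ 2) * (x ^ 3) ^ p.2)) =
      x ^ (p.1 ^ 2 + p.1 + 3 * (p.2 ^ 2 + p.2) + 1) := by
    rw [hz, hz, zpow_add₀ hx0 _ 1, zpow_add₀ hx0, mul_add, zpow_add₀ hx0, zpow_add₀ hx0,
      zpow_one]
    ring
  have hS := ((summable_mul_of_summable_norm s5 s6).mul_left x).congr hRterm
  rw [tsum_congr hRterm, ← tsum_odd_form_eq_tsum hS]
  refine tsum_congr fun p => ?_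
  rw [hz, zpow_add₀ hx0, zpow_add₀ (by norm_num), one_zpow, one_zpow]
  ring

/-! ### Theta series as products -/

/-- Since `s⁻¹ = s`, the two `z`-products of the triple product coincide. -/
lemma theta_sign_product {x s : ℂ} (hx0 : x ≠ 0) (hx : ‖x‖ < 1) (hs : s * s = 1) :
    (∏' n : ℕ, (1 - (x ^ 2) ^ (n + 1))) * (∏' n : ℕ, (1 + s * x ^ (2 * n + 1))) ^ 2 =
      ∑' j : ℤ, x ^ (j ^ 2) * s ^ j := by
  have hs0 : s ≠ 0 := left_ne_zero_of_mul_eq_one hs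
  rw [← jacobi_triple_product hx0 hx hs0, inv_eq_of_mul_eq_one_right hs, ← sq]
  simp only [mul_comm s]

/-- At `z = x` the product in `z⁻¹` starts one index earlier; its extra factor `1 + 1` is the 2. -/
lemma theta_two_product {x : ℂ} (hx0 : x ≠ 0) (hx : ‖x‖ < 1) :
    (∏' n : ℕ, (1 - (x ^ 2) ^ (n + 1))) * (2 * (∏' n : ℕ, (1 + (x ^ 2) ^ (n + 1))) ^ 2) =
      ∑' j : ℤ, x ^ (j ^ 2) * x ^ j := by
  have hq : ‖x ^ 2‖ < 1 := by
    rw [norm_pow]; exact pow_lt_one₀ (norm_nonneg x) hx two_ne_zero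
  rw [← jacobi_triple_product hx0 hx hx0]
  have h1 (n : ℕ) : 1 + x ^ (2 * n + 1) * x = 1 + (x ^ 2) ^ (n + 1) := by ring
  have h2 (n : ℕ) : 1 + x ^ (2 * n + 1) * x⁻¹ = 1 + (x ^ 2) ^ n := by
    rw [pow_succ, mul_assoc, mul_inv_cancel₀ hx0, mul_one, pow_mul]
  have h3 : ∏' n : ℕ, (1 + (x ^ 2) ^ n) = 2 * ∏' n : ℕ, (1 + (x ^ 2) ^ (n + 1)) := by
    have hm : Multipliable fun n : ℕ => 1 + (x ^ 2) ^ (n + 1) := by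
      simpa using multipliable_one_add_mul_pow hq 1 (f := fun n => n + 1) fun n => n.le_succ
    have h := tprod_eq_zero_mul' (f := fun n : ℕ => 1 + (x ^ 2) ^ n) hm
    rwa [pow_zero, one_add_one_eq_two] at h
  simp only [h1, h2, h3]
  ring

/-- The twisted Jacobi identity with the products written over `ℕ`. -/
theorem twisted_jacobi_nat {x : ℂ} (hx : ‖x‖ < 1) :
    (∏' n : ℕ, (1 + 1 * (x ^ 3) ^ (2 * n + 1))) ^ 2 *
        (∏' n : ℕ, (1 + 1 * x ^ (2 * n + 1))) ^ 2 -
      (∏' n : ℕ, (1 + -1 * (x ^ 3) ^ (2 * n + 1))) ^ 2 *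
        (∏' n : ℕ, (1 + -1 * x ^ (2 * n + 1))) ^ 2 =
    4 * x * ((∏' n : ℕ, (1 + ((x ^ 3) ^ 2) ^ (n + 1))) ^ 2 *
      (∏' n : ℕ, (1 + (x ^ 2) ^ (n + 1))) ^ 2) := by
  rcases eq_or_ne x 0 with rfl | hx0
  · simp
  have hy0 : x ^ 3 ≠ 0 := pow_ne_zero 3 hx0
  have hy : ‖x ^ 3‖ < 1 := by
    rw [norm_pow]; exact pow_lt_one₀ (norm_nonneg x) hx three_ne_zero
  have hE {y : ℂ} (hy : ‖y‖ < 1) : ∏' n : ℕ, (1 - (y ^ 2) ^ (n + 1)) ≠ 0 :=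
    tprod_one_sub_pow_succ_ne_zero (by
      rw [norm_pow]; exact pow_lt_one₀ (norm_nonneg y) hy two_ne_zero)
  have key := theta_cubic_identity hx0 hx
  rw [← theta_sign_product hx0 hx (one_mul 1), ← theta_sign_product hy0 hy (one_mul 1),
    ← theta_sign_product hx0 hx (by norm_num : (-1 : ℂ) * -1 = 1),
    ← theta_sign_product hy0 hy (by norm_num : (-1 : ℂ) * -1 = 1),
    ← theta_two_product hx0 hx, ← theta_two_product hy0 hy] at key
  refine mul_left_cancel₀ (mul_ne_zero (hE hx) (hE hy)) ?_
  linear_combination key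

/-! ### Eigenvalues for cycle shape `1^2 3^2` -/

section PermutationEigenvalues

open Equiv Equiv.Perm

/-- A permutation of cycle shape `1 ^ 2 3 ^ 2`. -/
def shapeRep : Perm (Fin 8) := finSumFinEquiv.permCongr (Perm.sumCongr
  (finSumFinEquiv.permCongr (Perm.sumCongr (finRotate 3) (finRotate 3))) (1 : Perm (Fin 2)))

lemma cycleType_shapeRep : shapeRep.cycleType = {3, 3} := by decide +kernel

lemma charpoly_finRotate_three :
    ((finRotate 3).permMatrix ℂ).charpoly = Polynomial.X ^ 3 - 1 := by
  simp [Matrix.charpoly, Matrix.charmatrix, Matrix.det_fin_three, PEquiv.toMatrix]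
  ring

lemma permMatrix_shapeRep : shapeRep.permMatrix ℂ =
    Matrix.reindex finSumFinEquiv finSumFinEquiv (Matrix.fromBlocks
      (Matrix.reindex finSumFinEquiv finSumFinEquiv (Matrix.fromBlocks
        ((finRotate 3).permMatrix ℂ) 0 0 ((finRotate 3).permMatrix ℂ)))
      0 0 (1 : Matrix (Fin 2) (Fin 2) ℂ)) := by
  ext i j
  fin_cases i <;> fin_cases j <;> rfl

lemma charpoly_permMatrix_of_isConj {α R : Type*} [Fintype α] [DecidableEq α] [CommRing R]
    {σ τ : Perm α} (h : IsConj σ τ) : (σ.permMatrix R).charpoly = (τ.permMatrix R).charpoly := by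
  obtain ⟨c, rfl⟩ := isConj_iff.mp h
  rw [← Matrix.charpoly_reindex c (σ.permMatrix R)]
  congr 1
  ext i j
  simp [PEquiv.toMatrix_apply, ← Equiv.eq_symm_apply, Perm.inv_def]

lemma charpoly_permMatrix_of_cycleType {σ : Perm (Fin 8)} (hσ : σ.cycleType = {3, 3}) :
    (σ.permMatrix ℂ).charpoly = (Polynomial.X ^ 3 - 1) ^ 2 * (Polynomial.X - 1) ^ 2 := by
  rw [charpoly_permMatrix_of_isConj
    (isConj_of_cycleType_eq (hσ.trans cycleType_shapeRep.symm)), permMatrix_shapeRep,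
    Matrix.charpoly_reindex, Matrix.charpoly_fromBlocks_zero₂₁, Matrix.charpoly_reindex,
    Matrix.charpoly_fromBlocks_zero₂₁, charpoly_finRotate_three, Matrix.charpoly_one, sq,
    Fintype.card_fin]

lemma exists_cubeRoot_coordEigenvalues {σ : Perm (Fin 8)} (hσ : σ.cycleType = {3, 3}) :
    ∃ ω : ℂ, ω ^ 2 + ω + 1 = 0 ∧
      coordEigenvalues σ = {1, 1, 1, 1, ω, ω, ω ^ 2, ω ^ 2} := by
  have h3 := Complex.isPrimitiveRoot_exp 3 (by norm_num)
  set ω := Complex.exp (2 * Real.pi * Complex.I / (3 : ℕ)) with hω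
  have h : ω ^ 2 + ω + 1 = 0 := by
    have := h3.geom_sum_eq_zero (by norm_num)
    simp only [Finset.sum_range_succ, Finset.range_zero, Finset.sum_empty] at this
    linear_combination this
  refine ⟨ω, h, ?_⟩
  rw [coordEigenvalues, charpoly_permMatrix_of_cycleType hσ]
  have hX : (Polynomial.X ^ 3 - 1) ^ 2 * (Polynomial.X - 1) ^ 2 =
      (Multiset.map (fun a => Polynomial.X - Polynomial.C a)
        ({1, 1, 1, 1, ω, ω, ω ^ 2, ω ^ 2} : Multiset ℂ)).prod := by
    have hC : (Polynomial.C ω) ^ 2 + Polynomial.C ω + 1 = 0 := by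
      rw [← map_pow, ← map_add, ← map_one Polynomial.C, ← map_add, h, map_zero]
    have h3 : (Polynomial.X ^ 3 - 1 : Polynomial ℂ) =
        (Polynomial.X - 1) * ((Polynomial.X - Polynomial.C ω) *
          (Polynomial.X - Polynomial.C ω ^ 2)) := by
      linear_combination (Polynomial.X - 1) * (Polynomial.X - Polynomial.C ω + 1) * hC
    rw [h3]
    simp only [Multiset.insert_eq_cons, Multiset.map_cons, Multiset.map_singleton,
      Multiset.prod_cons, Multiset.prod_singleton, map_one, map_pow]
    ring
  rw [hX, Polynomial.roots_multiset_prod_X_sub_C]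

lemma prod_coordEigenvalues {σ : Perm (Fin 8)} (hσ : σ.cycleType = {3, 3}) (a b : ℂ) :
    ((coordEigenvalues σ).map fun ε => (1 + a * ε) / (1 - b * ε)).prod =
      ((1 + a ^ 3) ^ 2 * (1 + a) ^ 2) * ((1 - b ^ 3) ^ 2 * (1 - b) ^ 2)⁻¹ := by
  obtain ⟨ω, h, hE⟩ := exists_cubeRoot_coordEigenvalues hσ
  -- Taking `c = a` gives the numerator, and `c = -b` the denominator.
  have key (c : ℂ) : 1 + c ^ 3 = (1 + c) * ((1 + c * ω) * (1 + c * ω ^ 2)) := by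
    linear_combination (1 + c) * (-c - c ^ 2 * (ω - 1)) * h
  have hb := key (-b)
  rw [key a, show 1 - b ^ 3 = 1 + (-b) ^ 3 by ring, hb, hE]
  simp only [Multiset.insert_eq_cons, Multiset.map_cons, Multiset.map_singleton,
    Multiset.prod_cons, Multiset.prod_singleton, mul_one, div_eq_mul_inv, mul_inv, ← inv_pow,
    neg_mul, ← sub_eq_add_neg, mul_pow]
  ring

lemma trace_permMatrix_of_cycleType {σ : Perm (Fin 8)} (hσ : σ.cycleType = {3, 3}) :
    (σ.permMatrix ℂ).trace = 2 := by
  obtain ⟨ω, h, hE⟩ := exists_cubeRoot_coordEigenvalues hσ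
  rw [Matrix.trace_eq_sum_roots_charpoly, ← coordEigenvalues, hE]
  simp only [Multiset.insert_eq_cons, Multiset.sum_cons, Multiset.sum_singleton]
  linear_combination 2 * h

end PermutationEigenvalues

/-! ### Products over positive integers and the identity -/

lemma hasProd_sq_mul_sq {a b : ℕ → ℂ} (ha : Multipliable a) (hb : Multipliable b) :
    HasProd (fun n => a n ^ 2 * b n ^ 2) ((∏' n, a n) ^ 2 * (∏' n, b n) ^ 2) :=
  (ha.hasProd.pow 2).mul (hb.hasProd.pow 2)

lemma hasProd_halfIntegralFactor {x : ℂ} (hx : ‖x‖ < 1) (s : ℂ) :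
    HasProd (halfIntegralFactor s x) ((∏' n : ℕ, (1 + s * (x ^ 3) ^ (2 * n + 1))) ^ 2 *
      (∏' n : ℕ, (1 + s * x ^ (2 * n + 1))) ^ 2) := by
  have hy : ‖x ^ 3‖ < 1 := by
    rw [norm_pow]; exact pow_lt_one₀ (norm_nonneg x) hx three_ne_zero
  refine (hasProd_pnat_iff_hasProd_succ (f := fun n : ℕ =>
    (1 + s * x ^ (6 * n - 3)) ^ 2 * (1 + s * x ^ (2 * n - 1)) ^ 2)).mpr ?_
  refine (hasProd_sq_mul_sq
    (multipliable_one_add_mul_pow hy s (f := fun n => 2 * n + 1) fun n => by omega)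
    (multipliable_one_add_mul_pow hx s (f := fun n => 2 * n + 1) fun n => by omega)).congr_fun
    fun n => ?_
  rw [← pow_mul, show 6 * (n + 1) - 3 = 3 * (2 * n + 1) by omega,
    show 2 * (n + 1) - 1 = 2 * n + 1 by omega]

lemma multipliable_one_add_pow_succ {q : ℂ} (hq : ‖q‖ < 1) :
    Multipliable (fun n : ℕ => 1 + q ^ (n + 1)) := by
  simpa using multipliable_one_add_mul_pow hq 1 (f := fun n => n + 1) fun n => n.le_succ

lemma hasProd_integralFactor {q : ℂ} (hq : ‖q‖ < 1) :
    HasProd (integralFactor q) ((∏' n : ℕ, (1 + (q ^ 3) ^ (n + 1))) ^ 2 *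
      (∏' n : ℕ, (1 + q ^ (n + 1))) ^ 2) := by
  have hy : ‖q ^ 3‖ < 1 := by
    rw [norm_pow]; exact pow_lt_one₀ (norm_nonneg q) hq three_ne_zero
  refine (hasProd_pnat_iff_hasProd_succ (f := fun n : ℕ =>
    (1 + q ^ (3 * n)) ^ 2 * (1 + q ^ n) ^ 2)).mpr ?_
  simpa only [pow_mul] using
    hasProd_sq_mul_sq (multipliable_one_add_pow_succ hy) (multipliable_one_add_pow_succ hq)

/-- The twisted Jacobi identity cleared of denominators. -/
theorem tprod_halfIntegralFactor_sub {x : ℂ} (hx : ‖x‖ < 1) :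
    (∏' n, halfIntegralFactor 1 x n) - ∏' n, halfIntegralFactor (-1) x n =
      4 * x * ∏' n, integralFactor (x ^ 2) n := by
  have hq : ‖x ^ 2‖ < 1 := by
    rw [norm_pow]; exact pow_lt_one₀ (norm_nonneg x) hx two_ne_zero
  rw [(hasProd_halfIntegralFactor hx 1).tprod_eq, (hasProd_halfIntegralFactor hx (-1)).tprod_eq,
    (hasProd_integralFactor hq).tprod_eq, twisted_jacobi_nat hx, pow_right_comm]

lemma twistedJacobiLHS_eq {x : ℂ} (hx0 : x ≠ 0) (hx : ‖x‖ < 1) :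
    twistedJacobiLHS x = twistedJacobiRHS (x ^ 2) := by
  rw [twistedJacobiLHS, twistedJacobiRHS, tprod_halfIntegralFactor_sub hx]
  field_simp
  ring

/-! ### The limit at `q = 0` -/

lemma tendsto_tprod_one_add_pow_succ :
    Tendsto (fun q : ℂ => ∏' n : ℕ, (1 + q ^ (n + 1))) (𝓝 0)
      (𝓝 (∏' n : ℕ, (1 + (0 : ℂ) ^ (n + 1)))) := by
  refine tendsto_tprod_one_add_of_dominated_convergence
    (bound := fun n : ℕ => (1 / 2 : ℝ) ^ n) summable_geometric_two
    (fun n => (continuous_pow (n + 1)).tendsto 0) ?_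
  filter_upwards [Metric.ball_mem_nhds (0 : ℂ) (by norm_num : (0 : ℝ) < 1 / 2)] with q hq n
  rw [mem_ball_zero_iff] at hq
  rw [norm_pow]
  calc ‖q‖ ^ (n + 1) ≤ (1 / 2) ^ (n + 1) := by gcongr
    _ ≤ (1 / 2) ^ n := pow_le_pow_of_le_one (by norm_num) (by norm_num) n.le_succ

lemma tendsto_twistedJacobiRHS : Tendsto twistedJacobiRHS (𝓝 0) (𝓝 (twistedJacobiRHS 0)) := by
  have h3 : Tendsto (fun q : ℂ => q ^ 3) (𝓝 0) (𝓝 0) := by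
    simpa using (continuous_pow (M := ℂ) 3).tendsto 0
  have h := (((tendsto_tprod_one_add_pow_succ.comp h3).pow 2).mul
    (tendsto_tprod_one_add_pow_succ.pow 2)).const_mul 2
  have h0 : twistedJacobiRHS 0 = 2 * ((∏' n : ℕ, (1 + (0 : ℂ) ^ (n + 1))) ^ 2 *
      (∏' n : ℕ, (1 + (0 : ℂ) ^ (n + 1))) ^ 2) := by
    rw [twistedJacobiRHS, (hasProd_integralFactor (by simp)).tprod_eq, zero_pow three_ne_zero]
  rw [h0]
  refine h.congr' ?_
  filter_upwards [Metric.ball_mem_nhds (0 : ℂ) one_pos] with q hq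
  rw [mem_ball_zero_iff] at hq
  rw [twistedJacobiRHS, (hasProd_integralFactor hq).tprod_eq]
  rfl

lemma tendsto_twistedJacobiLHS :
    Tendsto twistedJacobiLHS (𝓝[≠] 0) (𝓝 (twistedJacobiRHS 0)) := by
  have h2 : Tendsto (fun x : ℂ => x ^ 2) (𝓝[≠] 0) (𝓝 0) := by
    simpa using ((continuous_pow (M := ℂ) 2).tendsto 0).mono_left nhdsWithin_le_nhds
  refine (tendsto_twistedJacobiRHS.comp h2).congr' ?_
  filter_upwards [self_mem_nhdsWithin,
    mem_nhdsWithin_of_mem_nhds (Metric.ball_mem_nhds (0 : ℂ) one_pos)] with x hx0 hx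
  rw [mem_ball_zero_iff] at hx
  exact (twistedJacobiLHS_eq hx0 hx).symm

/-! ### Trace generating functions -/

/-- The common denominator `∏ (1 - ε q ^ n)` over the eigenvalues of a permutation of cycle shape
`1 ^ 2 3 ^ 2`. -/
noncomputable def traceDenom (q : ℂ) (n : ℕ+) : ℂ :=
  (1 - q ^ (3 * (n : ℕ))) ^ 2 * (1 - q ^ (n : ℕ)) ^ 2

/-- Inverting the product requires its limit to be nonzero, as it is for Euler products. -/
lemma multipliable_inv_traceDenom {q : ℂ} (hq : ‖q‖ < 1) :
    Multipliable (fun n => (traceDenom q n)⁻¹) := by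
  have hy : ‖q ^ 3‖ < 1 := by
    rw [norm_pow]; exact pow_lt_one₀ (norm_nonneg q) hq three_ne_zero
  have h : HasProd (traceDenom q) ((∏' n : ℕ, (1 - (q ^ 3) ^ (n + 1))) ^ 2 *
      (∏' n : ℕ, (1 - q ^ (n + 1))) ^ 2) := by
    refine (hasProd_pnat_iff_hasProd_succ (f := fun n : ℕ =>
      (1 - q ^ (3 * n)) ^ 2 * (1 - q ^ n) ^ 2)).mpr ?_
    simpa only [pow_mul] using
      hasProd_sq_mul_sq (multipliable_one_sub_pow_succ hy) (multipliable_one_sub_pow_succ hq)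
  have h0 := mul_ne_zero (pow_ne_zero 2 (tprod_one_sub_pow_succ_ne_zero hy))
    (pow_ne_zero 2 (tprod_one_sub_pow_succ_ne_zero hq))
  exact (h.inv₀ h0).multipliable

/-- The condition `s ^ 3 = s` covers both signs: cubing `s * x^(2n-1)` must leave the sign `s` in
front of `x^(6n-3)`. -/
lemma evenTraceFactor_eq {σ : Equiv.Perm (Fin 8)} (hσ : σ.cycleType = {3, 3}) {s : ℂ}
    (hs : s ^ 3 = s) (x : ℂ) :
    evenTraceFactor σ s x = fun n => halfIntegralFactor s x n * (traceDenom (x ^ 2) n)⁻¹ := by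
  ext n
  have hn := n.pos
  have h := prod_coordEigenvalues hσ (s * x ^ (2 * (n : ℕ) - 1)) (x ^ (2 * (n : ℕ)))
  rw [mul_pow, hs, ← pow_mul, ← pow_mul,
    show (2 * (n : ℕ) - 1) * 3 = 6 * n - 3 by omega] at h
  rw [evenTraceFactor, halfIntegralFactor, traceDenom, ← pow_mul, ← pow_mul,
    show 2 * (3 * (n : ℕ)) = 2 * n * 3 by ring, ← h]
  congr! 4 <;> ring

lemma oddTraceFactor_eq {σ : Equiv.Perm (Fin 8)} (hσ : σ.cycleType = {3, 3}) (x : ℂ) :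
    oddTraceFactor σ x = fun n => integralFactor (x ^ 2) n * (traceDenom (x ^ 2) n)⁻¹ := by
  ext n
  have h := prod_coordEigenvalues hσ (x ^ (2 * (n : ℕ))) (x ^ (2 * (n : ℕ)))
  rw [← pow_mul] at h
  rw [oddTraceFactor, integralFactor, traceDenom, ← pow_mul, ← pow_mul,
    show 2 * (3 * (n : ℕ)) = 2 * n * 3 by ring, ← h]
  congr! 4 <;> ring

/-- The twisted Jacobi identity of order 3. The square root of `q` is written `x`; either root of
`q` is allowed. At `q = 0` the left-hand side has a removable singularity. The last part is the
supersymmetry of the trace generating functions for an element of cycle shape `1^2 3^2`. -/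
theorem mainTheorem8 :
    (∀ q x : ℂ, ‖q‖ < 1 → x ^ 2 = q →
      Multipliable (halfIntegralFactor 1 x) ∧
      Multipliable (halfIntegralFactor (-1) x) ∧
      Multipliable (integralFactor q) ∧
      (q ≠ 0 → twistedJacobiLHS x = twistedJacobiRHS q)) ∧
    Tendsto twistedJacobiLHS (𝓝[≠] 0) (𝓝 (twistedJacobiRHS 0)) ∧
    (∀ σ : Equiv.Perm (Fin 8), σ.cycleType = {3, 3} →
      ∀ q x : ℂ, ‖q‖ < 1 → x ^ 2 = q →
        Multipliable (evenTraceFactor σ 1 x) ∧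
        Multipliable (evenTraceFactor σ (-1) x) ∧
        Multipliable (oddTraceFactor σ x) ∧
        evenTraceGenFun σ x = oddTraceGenFun σ x) := by
  have norm_lt {q x : ℂ} (hq : ‖q‖ < 1) (hxq : x ^ 2 = q) : ‖x‖ < 1 := by
    rw [← hxq, norm_pow] at hq
    exact (pow_lt_one_iff_of_nonneg (norm_nonneg x) two_ne_zero).mp hq
  refine ⟨fun q x hq hxq => ?_, tendsto_twistedJacobiLHS, fun σ hσ q x hq hxq => ?_⟩
  · have hx := norm_lt hq hxq
    refine ⟨(hasProd_halfIntegralFactor hx 1).multipliable,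
      (hasProd_halfIntegralFactor hx (-1)).multipliable,
      (hasProd_integralFactor hq).multipliable, fun hq0 => ?_⟩
    rw [← hxq]
    exact twistedJacobiLHS_eq (fun h => hq0 (by rw [← hxq, h, zero_pow two_ne_zero])) hx
  · have hx := norm_lt hq hxq
    subst hxq
    have h1 := (hasProd_halfIntegralFactor hx 1).multipliable
    have h2 := (hasProd_halfIntegralFactor hx (-1)).multipliable
    have h3 := (hasProd_integralFactor hq).multipliable
    have hD := multipliable_inv_traceDenom hq
    rw [evenTraceGenFun, oddTraceGenFun, evenTraceFactor_eq hσ (one_pow 3),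
      evenTraceFactor_eq hσ (by norm_num : (-1 : ℂ) ^ 3 = -1), oddTraceFactor_eq hσ]
    refine ⟨h1.mul hD, h2.mul hD, h3.mul hD, ?_⟩
    rw [h1.tprod_mul hD, h2.tprod_mul hD, h3.tprod_mul hD, ← sub_mul,
      tprod_halfIntegralFactor_sub hx, trace_permMatrix_of_cycleType hσ]
    ring
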